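/- A topological dynamical system (t.d.s.) is a pair $(X,T)$ with $X$ a compact metric space and $T:X\to X$ continuous and surjective. It is *transitive* if for all nonempty open $U,V\subset X$ the set $\{n\in\mathbb{Z}_{\ge 0}: T^{-n}V\cap U\neq\emptyset\}$ is infinite, *totally transitive* if $(X,T^n)$ is transitive for every integer $n\ge 1$, *weakly mixing* if $(X\times X,T\times T)$ is transitive, and a *$P$-system* if it is transitive and the set of periodic points $\{x\in X: T^nx=x \text{ for some } n\ge 1\}$ is dense in $X$. Let $M(X)$ be the set of Borel probability measures on $X$ with the weak$^*$ topology (a compact metrizable space), and let $T_M:M(X)\to M(X)$ be given by $(T_M\mu)(A)=\mu(T^{-1}A)$. For $k\ge 1$ let $\mathcal{E}(X,T^k)$ be the set of $T^k$-invariant ergodic $\mu\in M(X)$. The system $(X,T)$ *has almost dense periodic sets* if for every nonempty open $U\subset X$ and every $\varepsilon>0$ there are $k\ge 1$ and $\mu\in M(X)$ with $T_M^k\mu=\mu$ and $\mu(X\setminus U)<\varepsilon$; it is an *almost HY-system* if it is totally transitive and has almost dense periodic sets. These notions apply in the same way to $(M(X),T_M)$. **Theorem.** Let $(X,T)$ be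 a t.d.s. The following statements are equivalent: 1. $(X,T)$ is an almost HY-system. 2. $(X,T)$ is weakly mixing, and for every nonempty open $U\subset X$ and every $\varepsilon>0$ there are an integer $k\ge 1$ and $\mu\in\mathcal{E}(X,T^k)$ such that $\mu(X\setminus U)<\varepsilon$. 3. $(M(X),T_M)$ is a $P$-system. 4. $(M(X),T_M)$ is an almost HY-system. -/

import Mathlib

open MeasureTheory Set Filter Topology

noncomputable section

namespace InducedSystem

/-- On a compact metrizable space `X`, the measurable structure of `ProbabilityMeasure X`
(generated by the evaluations at measurable sets) is the Borel σ-algebra of the weak* topology.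
So measures on `ProbabilityMeasure X` are Borel measures. -/
instance borelSpace_probabilityMeasure {X : Type*} [TopologicalSpace X] [CompactSpace X]
    [TopologicalSpace.MetrizableSpace X] [MeasurableSpace X] [BorelSpace X] :
    BorelSpace (ProbabilityMeasure X) := by
  let _ : MetricSpace X := TopologicalSpace.metrizableSpaceMetric X
  let _ : MetricSpace (ProbabilityMeasure X) :=
    TopologicalSpace.metrizableSpaceMetric (ProbabilityMeasure X)
  constructor
  apply le_antisymm
  · have hval : @Measurable _ _ (borel (ProbabilityMeasure X)) _
        (fun μ : ProbabilityMeasure X => (μ : Measure X)) := by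
      let _ : MeasurableSpace (ProbabilityMeasure X) := borel _
      have _ : BorelSpace (ProbabilityMeasure X) := ⟨rfl⟩
      refine Measurable.measure_of_isPiSystem_of_isProbabilityMeasure
        (BorelSpace.measurable_eq (α := X)) isPiSystem_isOpen fun U hU => ?_
      refine LowerSemicontinuous.measurable fun μ y hy => ?_
      exact eventually_lt_of_lt_liminf (hy.trans_le
        (ProbabilityMeasure.le_liminf_measure_open_of_tendsto tendsto_id hU))
    exact hval.comap_le
  · have htop : (inferInstance : TopologicalSpace (ProbabilityMeasure X)) =
        TopologicalSpace.generateFrom (⋃ f : BoundedContinuousFunction X NNReal,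
          {s | ∃ O, IsOpen O ∧
            (fun μ : ProbabilityMeasure X => μ.toFiniteMeasure.testAgainstNN f) ⁻¹' O = s}) := by
      have h1 : (inferInstance : TopologicalSpace (ProbabilityMeasure X)) =
          ⨅ f : BoundedContinuousFunction X NNReal, TopologicalSpace.induced
            (fun μ : ProbabilityMeasure X => μ.toFiniteMeasure.testAgainstNN f)
              inferInstance := by
        have h2 : IsInducing (fun (μ : ProbabilityMeasure X)
            (f : BoundedContinuousFunction X NNReal) => μ.toFiniteMeasure.testAgainstNN f) :=
          IsInducing.comp (g := fun (φ : WeakDual NNReal (BoundedContinuousFunction X NNReal))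
            (f : BoundedContinuousFunction X NNReal) => φ f) ⟨rfl⟩
            (IsInducing.comp (g := FiniteMeasure.toWeakDualBCNN) ⟨rfl⟩
              (ProbabilityMeasure.toFiniteMeasure_isEmbedding X).isInducing)
        refine h2.eq_induced.trans ?_
        rw [Pi.topologicalSpace, induced_iInf]
        simp only [induced_compose]
        rfl
      rw [h1, generateFrom_iUnion]
      congr 1
      funext f
      exact (@TopologicalSpace.generateFrom_setOfPred_isOpen _ (TopologicalSpace.induced _ _)).symm
    rw [borel_eq_generateFrom_of_subbasis htop]
    refine MeasurableSpace.generateFrom_le ?_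
    rintro s hs
    obtain ⟨f, O, hO, rfl⟩ := mem_iUnion.1 hs
    refine (Measurable.ennreal_toNNReal ?_) hO.measurableSet
    exact (Measure.measurable_lintegral
      (measurable_coe_nnreal_ennreal.comp f.continuous.measurable)).comp measurable_subtype_coe

/-- The map `T_M` induced by a continuous map `T` on the space `M(X)` of Borel probability
measures with the weak* topology: `(T_M μ)(A) = μ(T⁻¹ A)`. -/
def inducedMap {X : Type*} [TopologicalSpace X] [MeasurableSpace X] [BorelSpace X]
    (T : C(X, X)) : C(ProbabilityMeasure X, ProbabilityMeasure X) where
  toFun μ := μ.map T.continuous.measurable.aemeasurable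
  continuous_toFun := ProbabilityMeasure.continuous_map T.continuous

/-- `T` is transitive: for all non-empty open `U`, `V`, the set
`N(U, V) = {n ≥ 0 : T⁻ⁿ V ∩ U ≠ ∅}` is infinite. -/
def IsTransitive {X : Type*} [TopologicalSpace X] (T : X → X) : Prop :=
  ∀ U V : Set X, IsOpen U → U.Nonempty → IsOpen V → V.Nonempty →
    {n : ℕ | ((T^[n]) ⁻¹' V ∩ U).Nonempty}.Infinite

/-- `T` is totally transitive: `Tⁿ` is transitive for every `n ≥ 1`. -/
def IsTotallyTransitive {X : Type*} [TopologicalSpace X] (T : X → X) : Prop :=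
  ∀ n : ℕ, 1 ≤ n → IsTransitive (T^[n])

/-- `T` is weakly mixing: `T × T` is transitive on `X × X`. -/
def IsWeaklyMixing {X : Type*} [TopologicalSpace X] (T : X → X) : Prop :=
  IsTransitive (Prod.map T T)

/-- `T` is a `P`-system: it is transitive and its periodic points are dense. -/
def IsPSystem {X : Type*} [TopologicalSpace X] (T : X → X) : Prop :=
  IsTransitive T ∧ Dense {x : X | ∃ n : ℕ, 1 ≤ n ∧ T^[n] x = x}

/-- `T` has almost dense periodic sets: for every non-empty open `U` and `ε > 0` there are
`k ≥ 1` and a Borel probability measure `μ` with `T_M^k μ = μ` and `μ(Uᶜ) < ε`. -/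
def HasAlmostDensePeriodicSets {X : Type*} [TopologicalSpace X] [MeasurableSpace X]
    [BorelSpace X] (T : C(X, X)) : Prop :=
  ∀ U : Set X, IsOpen U → U.Nonempty → ∀ ε : ℝ, 0 < ε →
    ∃ k : ℕ, 1 ≤ k ∧ ∃ μ : ProbabilityMeasure X,
      (inducedMap T)^[k] μ = μ ∧ (μ Uᶜ : ℝ) < ε

/-- `T` is an almost HY-system: totally transitive with almost dense periodic sets. -/
def IsAlmostHYSystem {X : Type*} [TopologicalSpace X] [MeasurableSpace X]
    [BorelSpace X] (T : C(X, X)) : Prop :=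
  IsTotallyTransitive T ∧ HasAlmostDensePeriodicSets T

end InducedSystem

end

/-! Weak mixing of `T` is the hinge of the cycle.

A `T^k`-invariant measure giving an open set C mass above 1/2 forces every multiple of k into N(C,
C), while transitivity of `T^k` puts a multiple of k into N(A, B). Petersen's criterion then gives
weak mixing. Ergodic measures come from Krein–Milman, applied to the invariant measures minimizing
the integral of a continuous majorant of the indicator of Uᶜ.

Conversely, finitely supported measures are dense in M(X). Weak mixing moves finitely many atoms
simultaneously, so `T_M` is totally transitive. Measures concentrating near points make the Dirac
masses limits of `T_M`-periodic measures, and convex combinations of these are again periodic, hence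
periodic measures are dense.

To return to `T`, transitivity of `T_M` near (δ_x + δ_y)/2 gives weak mixing, and barycenters carry
periodic measures on M(X) to periodic measures on X. -/

noncomputable section

namespace InducedSystem

/-! ### Hitting times, transitivity and weak mixing. -/

section HittingTimes

variable {X : Type*} {T : X → X}

/-- The set `N(U, V)` of times at which `U` meets the preimage of `V`. -/
def hittingTimes (T : X → X) (U V : Set X) : Set ℕ :=
  {n : ℕ | ((T^[n]) ⁻¹' V ∩ U).Nonempty}

theorem mem_hittingTimes {U V : Set X} {n : ℕ} :
    n ∈ hittingTimes T U V ↔ ∃ x ∈ U, T^[n] x ∈ V :=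
  ⟨fun ⟨x, hV, hU⟩ => ⟨x, hU, hV⟩, fun ⟨x, hU, hV⟩ => ⟨x, hV, hU⟩⟩

end HittingTimes

section TopologicalDynamics

variable {X : Type*} [TopologicalSpace X] {T : X → X}

/-- For a continuous surjection, transitivity only needs one hitting time. -/
theorem isTransitive_of_nonempty_hittingTimes (hc : Continuous T) (hs : Function.Surjective T)
    (h : ∀ U V : Set X, IsOpen U → U.Nonempty → IsOpen V → V.Nonempty →
      (hittingTimes T U V).Nonempty) : IsTransitive T := by
  intro U V hU hUn hV hVn
  refine infinite_of_forall_exists_gt fun K => ?_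
  -- Pulling V back by `K + 1` steps turns any hitting time into one beyond `K`; surjectivity keeps
  -- the target nonempty.
  obtain ⟨n, hn⟩ := h U (T^[K + 1] ⁻¹' V) hU hUn (hV.preimage (hc.iterate _))
    (hVn.preimage (hs.iterate _))
  obtain ⟨x, hxU, hxV⟩ := mem_hittingTimes.1 hn
  refine ⟨K + 1 + n, mem_hittingTimes.2 ⟨x, hxU, ?_⟩, by omega⟩
  rwa [Function.iterate_add_apply]

theorem IsTransitive.nonempty_hittingTimes (h : IsTransitive T) {U V : Set X} (hU : IsOpen U)
    (hUn : U.Nonempty) (hV : IsOpen V) (hVn : V.Nonempty) : (hittingTimes T U V).Nonempty :=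
  (h U V hU hUn hV hVn).nonempty

theorem IsTotallyTransitive.isTransitive (h : IsTotallyTransitive T) : IsTransitive T :=
  h 1 le_rfl

theorem IsWeaklyMixing.exists_mem_hittingTimes (h : IsWeaklyMixing T) {U₁ V₁ U₂ V₂ : Set X}
    (hU₁ : IsOpen U₁) (hU₁n : U₁.Nonempty) (hV₁ : IsOpen V₁) (hV₁n : V₁.Nonempty)
    (hU₂ : IsOpen U₂) (hU₂n : U₂.Nonempty) (hV₂ : IsOpen V₂) (hV₂n : V₂.Nonempty) :
    ∃ n, n ∈ hittingTimes T U₁ V₁ ∧ n ∈ hittingTimes T U₂ V₂ := by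
  obtain ⟨n, ⟨x, y⟩, hV, hU⟩ := (h (U₁ ×ˢ U₂) (V₁ ×ˢ V₂) (hU₁.prod hU₂) (hU₁n.prod hU₂n)
    (hV₁.prod hV₂) (hV₁n.prod hV₂n)).nonempty
  rw [mem_preimage, Prod.map_iterate] at hV
  exact ⟨n, ⟨x, hV.1, hU.1⟩, ⟨y, hV.2, hU.2⟩⟩

theorem IsWeaklyMixing.isTransitive (h : IsWeaklyMixing T) : IsTransitive T := by
  intro U V hU hUn hV hVn
  refine (h (U ×ˢ U) (V ×ˢ V) (hU.prod hU) (hUn.prod hUn) (hV.prod hV) (hVn.prod hVn)).mono ?_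
  rintro n ⟨⟨x, y⟩, hV, hU⟩
  rw [mem_preimage, Prod.map_iterate] at hV
  exact ⟨x, hV.1, hU.1⟩

theorem isWeaklyMixing_of_exists_mem_hittingTimes (hc : Continuous T)
    (hs : Function.Surjective T)
    (h : ∀ U₁ V₁ U₂ V₂ : Set X, IsOpen U₁ → U₁.Nonempty → IsOpen V₁ → V₁.Nonempty →
      IsOpen U₂ → U₂.Nonempty → IsOpen V₂ → V₂.Nonempty →
      ∃ n, n ∈ hittingTimes T U₁ V₁ ∧ n ∈ hittingTimes T U₂ V₂) : IsWeaklyMixing T := by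
  refine isTransitive_of_nonempty_hittingTimes (hc.prodMap hc) (hs.prodMap hs) ?_
  rintro U V hU ⟨⟨u₁, u₂⟩, hu⟩ hV ⟨⟨v₁, v₂⟩, hv⟩
  obtain ⟨A₁, A₂, hA₁, hA₂, hu₁, hu₂, hA⟩ := isOpen_prod_iff.1 hU u₁ u₂ hu
  obtain ⟨B₁, B₂, hB₁, hB₂, hv₁, hv₂, hB⟩ := isOpen_prod_iff.1 hV v₁ v₂ hv
  obtain ⟨n, ⟨x, hxB, hxA⟩, ⟨y, hyB, hyA⟩⟩ := h A₁ B₁ A₂ B₂ hA₁ ⟨_, hu₁⟩ hB₁ ⟨_, hv₁⟩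
    hA₂ ⟨_, hu₂⟩ hB₂ ⟨_, hv₂⟩
  refine ⟨n, (x, y), ?_, hA ⟨hxA, hyA⟩⟩
  rw [mem_preimage, Prod.map_iterate]
  exact hB ⟨hxB, hyB⟩

/-- Petersen's criterion for weak mixing. -/
theorem isWeaklyMixing_of_self_hittingTimes (hc : Continuous T) (hs : Function.Surjective T)
    (h : ∀ A B C : Set X, IsOpen A → A.Nonempty → IsOpen B → B.Nonempty → IsOpen C →
      C.Nonempty → ∃ n, n ∈ hittingTimes T A B ∧ n ∈ hittingTimes T C C) :
    IsWeaklyMixing T := by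
  refine isWeaklyMixing_of_exists_mem_hittingTimes hc hs ?_
  intro U₁ V₁ U₂ V₂ hU₁ hU₁n hV₁ hV₁n hU₂ hU₂n hV₂ hV₂n
  -- A return time n of U₂ ∩ T⁻ᵃV₂ to itself makes a + n a hitting time from U₂ to V₂.
  obtain ⟨a, ha, -⟩ := h U₂ V₂ U₂ hU₂ hU₂n hV₂ hV₂n hU₂ hU₂n
  obtain ⟨n, hn₁, hn₂⟩ := h U₁ (T^[a] ⁻¹' V₁) (T^[a] ⁻¹' V₂ ∩ U₂) hU₁ hU₁n
    (hV₁.preimage (hc.iterate a)) (hV₁n.preimage (hs.iterate a))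
    ((hV₂.preimage (hc.iterate a)).inter hU₂) ha
  obtain ⟨x, hx, hx'⟩ := mem_hittingTimes.1 hn₁
  obtain ⟨y, hy, hy'⟩ := mem_hittingTimes.1 hn₂
  refine ⟨a + n, mem_hittingTimes.2 ⟨x, hx, ?_⟩, mem_hittingTimes.2 ⟨y, hy.2, ?_⟩⟩
  · rwa [Function.iterate_add_apply]
  · rw [Function.iterate_add_apply]
    exact hy'.1

/-- If `N(A, C)` and `N(B, C)` always meet, then `T` is weakly mixing. -/
theorem isWeaklyMixing_of_common_target (hc : Continuous T) (hs : Function.Surjective T)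
    (h : ∀ A B C : Set X, IsOpen A → A.Nonempty → IsOpen B → B.Nonempty → IsOpen C →
      C.Nonempty → ∃ n, n ∈ hittingTimes T A C ∧ n ∈ hittingTimes T B C) :
    IsWeaklyMixing T := by
  refine isWeaklyMixing_of_self_hittingTimes hc hs ?_
  intro A B C hA hAn hB hBn hC hCn
  obtain ⟨n, ⟨x, hxC, hxA⟩, ⟨y, hyC, hyB⟩⟩ := h A B C hA hAn hB hBn hC hCn
  have hAC : IsOpen (T^[n] ⁻¹' C ∩ A) := (hC.preimage (hc.iterate n)).inter hA
  have hBC : IsOpen (T^[n] ⁻¹' C ∩ B) := (hC.preimage (hc.iterate n)).inter hB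
  -- A point z going from the first set to the last in m steps goes from A to B, while T^n z returns
  -- to C.
  obtain ⟨m, hm, -⟩ := h (T^[n] ⁻¹' C ∩ A) (T^[n] ⁻¹' C ∩ A) (T^[n] ⁻¹' C ∩ B) hAC
    ⟨x, hxC, hxA⟩ hAC ⟨x, hxC, hxA⟩ hBC ⟨y, hyC, hyB⟩
  obtain ⟨z, hz, hz'⟩ := mem_hittingTimes.1 hm
  refine ⟨m, mem_hittingTimes.2 ⟨z, hz.2, hz'.2⟩, mem_hittingTimes.2 ⟨T^[n] z, hz.1, ?_⟩⟩
  rw [← Function.iterate_add_apply, add_comm, Function.iterate_add_apply]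
  exact hz'.1

/-- Furstenberg's intersection lemma. -/
theorem IsWeaklyMixing.exists_hittingTimes_subset_inter (h : IsWeaklyMixing T)
    (hc : Continuous T) {U₁ V₁ U₂ V₂ : Set X}
    (hU₁ : IsOpen U₁) (hU₁n : U₁.Nonempty) (hV₁ : IsOpen V₁) (hV₁n : V₁.Nonempty)
    (hU₂ : IsOpen U₂) (hU₂n : U₂.Nonempty) (hV₂ : IsOpen V₂) (hV₂n : V₂.Nonempty) :
    ∃ A B : Set X, IsOpen A ∧ A.Nonempty ∧ IsOpen B ∧ B.Nonempty ∧
      hittingTimes T A B ⊆ hittingTimes T U₁ V₁ ∩ hittingTimes T U₂ V₂ := by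
  -- `T^k` shifts an orbit piece from U₁ to V₁ into one from U₂ to V₂ of the same length.
  obtain ⟨k, hkU, hkV⟩ := h.exists_mem_hittingTimes hU₁ hU₁n hU₂ hU₂n hV₁ hV₁n hV₂ hV₂n
  refine ⟨T^[k] ⁻¹' U₂ ∩ U₁, T^[k] ⁻¹' V₂ ∩ V₁, (hU₂.preimage (hc.iterate k)).inter hU₁, hkU,
    (hV₂.preimage (hc.iterate k)).inter hV₁, hkV, ?_⟩
  intro n hn
  obtain ⟨x, hx, hx'⟩ := mem_hittingTimes.1 hn
  refine ⟨mem_hittingTimes.2 ⟨x, hx.2, hx'.2⟩, mem_hittingTimes.2 ⟨T^[k] x, hx.1, ?_⟩⟩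
  rw [← Function.iterate_add_apply, add_comm, Function.iterate_add_apply]
  exact hx'.1

theorem IsWeaklyMixing.exists_hittingTimes_subset_iInter [Nonempty X] (h : IsWeaklyMixing T)
    (hc : Continuous T) {ι : Type*} (s : Finset ι) (U V : ι → Set X)
    (hU : ∀ i, IsOpen (U i)) (hUn : ∀ i, (U i).Nonempty)
    (hV : ∀ i, IsOpen (V i)) (hVn : ∀ i, (V i).Nonempty) :
    ∃ A B : Set X, IsOpen A ∧ A.Nonempty ∧ IsOpen B ∧ B.Nonempty ∧
      ∀ n ∈ hittingTimes T A B, ∀ i ∈ s, n ∈ hittingTimes T (U i) (V i) := by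
  classical
  induction s using Finset.induction_on with
  | empty => exact ⟨univ, univ, isOpen_univ, univ_nonempty, isOpen_univ, univ_nonempty, by simp⟩
  | insert i s _ ih =>
    obtain ⟨A, B, hA, hAn, hB, hBn, hAB⟩ := ih
    obtain ⟨A', B', hA', hAn', hB', hBn', hAB'⟩ := h.exists_hittingTimes_subset_inter hc
      hA hAn hB hBn (hU i) (hUn i) (hV i) (hVn i)
    refine ⟨A', B', hA', hAn', hB', hBn', fun n hn j hj => ?_⟩
    rcases Finset.mem_insert.1 hj with rfl | hj
    · exact (hAB' hn).2
    · exact hAB n (hAB' hn).1 j hj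

/-- Some n hits all the sets T⁻ⁱV with i < k at once; choosing i ≡ -n mod k makes i + n a multiple
of k. -/
theorem IsWeaklyMixing.isTotallyTransitive (h : IsWeaklyMixing T) (hc : Continuous T)
    (hs : Function.Surjective T) : IsTotallyTransitive T := by
  intro k hk
  refine isTransitive_of_nonempty_hittingTimes (hc.iterate k) (hs.iterate k) ?_
  intro U V hU hUn hV hVn
  have : Nonempty X := hUn.to_type
  obtain ⟨A, B, hA, hAn, hB, hBn, hAB⟩ := h.exists_hittingTimes_subset_iInter hc
    (Finset.range k) (fun _ => U) (fun i => T^[i] ⁻¹' V) (fun _ => hU) (fun _ => hUn)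
    (fun i => hV.preimage (hc.iterate i)) (fun i => hVn.preimage (hs.iterate i))
  obtain ⟨n, hn⟩ := h.isTransitive.nonempty_hittingTimes hA hAn hB hBn
  obtain ⟨i, hi, m, hm⟩ : ∃ i < k, ∃ m, i + n = k * m := by
    have hlt := Nat.mod_lt n hk
    rcases Nat.eq_zero_or_pos (n % k) with h0 | h0
    · exact ⟨0, hk, n / k, by have := Nat.div_add_mod n k; omega⟩
    · refine ⟨k - n % k, by omega, n / k + 1, ?_⟩
      have := Nat.div_add_mod n k
      rw [mul_add]
      omega
  obtain ⟨x, hxU, hxV⟩ := mem_hittingTimes.1 (hAB n hn i (Finset.mem_range.2 hi))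
  refine ⟨m, mem_hittingTimes.2 ⟨x, hxU, ?_⟩⟩
  rwa [← Function.iterate_mul, ← hm, Function.iterate_add_apply]

end TopologicalDynamics

/-! ### Finite convex combinations of measures. -/

section Mixture

variable {X : Type*} [MeasurableSpace X] {ι : Type*} [Fintype ι]

/-- The convex combination `∑ i, a i • μ i` of probability measures. -/
def mixture (a : ι → NNReal) (ha : ∑ i, a i = 1) (μ : ι → ProbabilityMeasure X) :
    ProbabilityMeasure X :=
  ⟨∑ i, a i • (μ i : Measure X), ⟨by
    simp only [Measure.finsetSum_apply, Measure.smul_apply, measure_univ, ENNReal.smul_def,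
      smul_eq_mul, mul_one]
    exact_mod_cast ha⟩⟩

variable {a : ι → NNReal} {ha : ∑ i, a i = 1}

theorem coe_mixture (μ : ι → ProbabilityMeasure X) :
    (mixture a ha μ : Measure X) = ∑ i, a i • (μ i : Measure X) := rfl

theorem mixture_apply (μ : ι → ProbabilityMeasure X) (s : Set X) :
    (mixture a ha μ : Measure X) s = ∑ i, a i * (μ i : Measure X) s := by
  simp only [coe_mixture, Measure.finsetSum_apply, Measure.smul_apply, ENNReal.smul_def,
    smul_eq_mul]

/-- With `mixture_snd`, this writes two mixtures over one index set with the same product weights,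
so that atoms can be matched in pairs. -/
theorem mixture_fst {κ : Type*} [Fintype κ] {b : κ → NNReal}
    (ha : ∑ i, a i = 1) (hb : ∑ j, b j = 1) (hab : ∑ p : ι × κ, a p.1 * b p.2 = 1)
    (μ : ι → ProbabilityMeasure X) :
    mixture (fun p : ι × κ => a p.1 * b p.2) hab (fun p => μ p.1) = mixture a ha μ := by
  refine ProbabilityMeasure.toMeasure_injective (Measure.ext fun s hs => ?_)
  rw [mixture_apply, mixture_apply, Fintype.sum_prod_type]
  refine Finset.sum_congr rfl fun i _ => ?_
  have hb' : ∑ j, (b j : ENNReal) = 1 := by exact_mod_cast hb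
  simp only [ENNReal.coe_mul]
  rw [← Finset.sum_mul, ← Finset.mul_sum, hb', mul_one]

theorem mixture_snd {κ : Type*} [Fintype κ] {b : κ → NNReal}
    (ha : ∑ i, a i = 1) (hb : ∑ j, b j = 1) (hab : ∑ p : ι × κ, a p.1 * b p.2 = 1)
    (μ : κ → ProbabilityMeasure X) :
    mixture (fun p : ι × κ => a p.1 * b p.2) hab (fun p => μ p.2) = mixture b hb μ := by
  refine ProbabilityMeasure.toMeasure_injective (Measure.ext fun s hs => ?_)
  rw [mixture_apply, mixture_apply, Fintype.sum_prod_type_right]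
  refine Finset.sum_congr rfl fun j _ => ?_
  have ha' : ∑ i, (a i : ENNReal) = 1 := by exact_mod_cast ha
  simp only [ENNReal.coe_mul]
  rw [← Finset.sum_mul, ← Finset.sum_mul, ha', one_mul]

variable [TopologicalSpace X]

theorem integral_mixture [OpensMeasurableSpace X] (μ : ι → ProbabilityMeasure X)
    (f : BoundedContinuousFunction X ℝ) :
    ∫ x, f x ∂(mixture a ha μ : Measure X) = ∑ i, a i * ∫ x, f x ∂(μ i : Measure X) := by
  rw [coe_mixture, integral_finsetSum_measure fun i _ => (f.integrable _).smul_measure_nnreal]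
  simp [integral_smul_nnreal_measure, NNReal.smul_def]

theorem continuous_mixture [OpensMeasurableSpace X] : Continuous (mixture (X := X) a ha) := by
  refine continuous_iff_continuousAt.2 fun μ => ?_
  refine ProbabilityMeasure.tendsto_iff_forall_integral_tendsto.2 fun f => ?_
  simp only [integral_mixture]
  refine tendsto_finsetSum _ fun i _ => Tendsto.const_mul _ ?_
  exact ProbabilityMeasure.tendsto_iff_forall_integral_tendsto.1
    ((continuous_apply i).tendsto μ) f

end Mixture

section ProbabilityMeasure

variable {X : Type*} [MeasurableSpace X]

theorem exists_notMem_of_apply_add_lt_one (μ : ProbabilityMeasure X) {s t : Set X}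
    (h : (μ s : ℝ) + μ t < 1) : ∃ x, x ∉ s ∧ x ∉ t := by
  by_contra! H
  have hst : s ∪ t = univ := eq_univ_of_forall fun x => or_iff_not_imp_left.2 (H x)
  have h1 := μ.apply_union_le (s₁ := s) (s₂ := t)
  rw [hst, ProbabilityMeasure.coeFn_univ] at h1
  have h2 : (1 : ℝ) ≤ μ s + μ t := by exact_mod_cast h1
  linarith

end ProbabilityMeasure

/-! ### The induced map and its periodic measures. -/

section InducedMap

variable {X : Type*} [TopologicalSpace X] [MeasurableSpace X] [BorelSpace X] {T : C(X, X)}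

theorem coe_inducedMap (μ : ProbabilityMeasure X) :
    (inducedMap T μ : Measure X) = (μ : Measure X).map T := rfl

theorem coe_inducedMap_iterate (n : ℕ) (μ : ProbabilityMeasure X) :
    (((inducedMap T)^[n] μ : ProbabilityMeasure X) : Measure X) = (μ : Measure X).map T^[n] := by
  induction n with
  | zero => simp
  | succ n ih =>
    rw [Function.iterate_succ_apply', coe_inducedMap, ih,
      Measure.map_map T.continuous.measurable (T.continuous.iterate n).measurable,
      Function.iterate_succ']

theorem inducedMap_iterate_apply (n : ℕ) (μ : ProbabilityMeasure X) {s : Set X}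
    (hs : MeasurableSet s) : ((inducedMap T)^[n] μ) s = μ (T^[n] ⁻¹' s) := by
  simp only [ProbabilityMeasure.coeFn_def]
  rw [coe_inducedMap_iterate, Measure.map_apply (T.continuous.iterate n).measurable hs]

theorem inducedMap_iterate_eq_self_iff {n : ℕ} {μ : ProbabilityMeasure X} :
    (inducedMap T)^[n] μ = μ ↔ MeasurePreserving T^[n] (μ : Measure X) μ := by
  rw [← ProbabilityMeasure.toMeasure_injective.eq_iff, coe_inducedMap_iterate]
  exact ⟨fun h => ⟨(T.continuous.iterate n).measurable, h⟩, fun h => h.map_eq⟩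

theorem inducedMap_iterate_mixture (n : ℕ) {ι : Type*} [Fintype ι] {a : ι → NNReal}
    {ha : ∑ i, a i = 1} (μ : ι → ProbabilityMeasure X) :
    (inducedMap T)^[n] (mixture a ha μ) = mixture a ha fun i => (inducedMap T)^[n] (μ i) := by
  refine ProbabilityMeasure.toMeasure_injective (Measure.ext fun s hs => ?_)
  have hT := (T.continuous.iterate n).measurable
  rw [coe_inducedMap_iterate, Measure.map_apply hT hs, mixture_apply, mixture_apply]
  simp only [coe_inducedMap_iterate, Measure.map_apply hT hs]

theorem inducedMap_iterate_diracProba (n : ℕ) (x : X) :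
    (inducedMap T)^[n] (diracProba x) = diracProba (T^[n] x) := by
  refine ProbabilityMeasure.toMeasure_injective ?_
  rw [coe_inducedMap_iterate]
  exact Measure.map_dirac' (T.continuous.iterate n).measurable x

theorem HasAlmostDensePeriodicSets.of_dense_periodic
    (h : Dense {x : X | ∃ n : ℕ, 1 ≤ n ∧ T^[n] x = x}) : HasAlmostDensePeriodicSets T := by
  intro U hU hUn ε hε
  obtain ⟨x, hxU, n, hn, hx⟩ := h.inter_open_nonempty U hU hUn
  refine ⟨n, hn, diracProba x, ?_, ?_⟩
  · rw [inducedMap_iterate_diracProba, hx]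
  · simp [ProbabilityMeasure.coeFn_def,
      diracProba_toMeasure_apply' _ hU.measurableSet.compl, hxU, hε]

/-- The measures that are periodic under the induced map. -/
def periodicMeasures (T : C(X, X)) : Set (ProbabilityMeasure X) :=
  {μ | ∃ n : ℕ, 1 ≤ n ∧ (inducedMap T)^[n] μ = μ}

/-- The product of the periods is a common period. -/
theorem mixture_mem_periodicMeasures {ι : Type*} [Fintype ι] {a : ι → NNReal}
    {ha : ∑ i, a i = 1} {μ : ι → ProbabilityMeasure X} (hμ : ∀ i, μ i ∈ periodicMeasures T) :
    mixture a ha μ ∈ periodicMeasures T := by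
  choose k hk hkμ using hμ
  refine ⟨∏ i, k i, Finset.one_le_prod' fun i _ => hk i, ?_⟩
  rw [inducedMap_iterate_mixture]
  congr 1
  funext i
  have hi : Function.IsPeriodicPt (inducedMap T) (k i) (μ i) := hkμ i
  exact hi.trans_dvd (Finset.dvd_prod_of_mem k (Finset.mem_univ i))

/-- By the portmanteau theorem, the mass of a closed set is upper semicontinuous. -/
theorem isOpen_setOf_apply_lt [HasOuterApproxClosed X] {F : Set X} (hF : IsClosed F) (c : ℝ) :
    IsOpen {μ : ProbabilityMeasure X | (μ F : ℝ) < c} := by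
  have h : UpperSemicontinuous fun μ : ProbabilityMeasure X => (μ : Measure X) F :=
    fun μ y hy => eventually_lt_of_limsup_lt
      ((ProbabilityMeasure.limsup_measure_closed_le_of_tendsto tendsto_id hF).trans_lt hy)
  convert h.isOpen_preimage (ENNReal.ofReal c) using 1
  ext μ
  simp only [mem_ofPred_eq, mem_preimage, mem_Iio]
  rw [ENNReal.lt_ofReal_iff_toReal_lt (measure_ne_top _ _)]
  rfl

end InducedMap

/-! ### Density of finitely supported measures. -/

section FiniteSupport

variable {X : Type*} [MeasurableSpace X]

theorem coe_mixture_diracProba_eq_map (μ : ProbabilityMeasure X) {n : ℕ} (g : X → Fin n)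
    (hg : Measurable g) (e : Fin n → X) (ha : ∑ k, μ (g ⁻¹' {k}) = 1) :
    (mixture (fun k => μ (g ⁻¹' {k})) ha fun k => diracProba (e k) : Measure X) =
      (μ : Measure X).map (e ∘ g) := by
  have he : Measurable e := measurable_from_top
  rw [← Measure.map_map he hg, Measure.map_eq_sum _ g hg, Measure.sum_fintype, coe_mixture]
  ext s hs
  rw [Measure.map_apply he hs]
  simp only [Measure.finsetSum_apply, Measure.smul_apply, smul_eq_mul, ENNReal.smul_def]
  refine Finset.sum_congr rfl fun k _ => ?_
  rw [ProbabilityMeasure.ennreal_coeFn_eq_coeFn_toMeasure, Measure.dirac_apply' _ (he hs),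
    diracProba_toMeasure_apply' _ hs]
  rfl

theorem sum_apply_fiber (μ : ProbabilityMeasure X) {n : ℕ} (g : X → Fin n)
    (hg : Measurable g) : ∑ k, μ (g ⁻¹' {k}) = 1 := by
  rw [← ENNReal.coe_inj, ENNReal.ofNNReal_finsetSum]
  simp only [ProbabilityMeasure.ennreal_coeFn_eq_coeFn_toMeasure]
  rw [sum_measure_preimage_singleton _ fun k _ => hg (measurableSet_singleton k)]
  simp

end FiniteSupport

section DenseFiniteSupport

variable {X : Type*} [MetricSpace X] [CompactSpace X] [MeasurableSpace X] [BorelSpace X]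

/-- The finitely supported measures are weak* dense. -/
theorem exists_mixture_diracProba_mem {𝒰 : Set (ProbabilityMeasure X)} (h𝒰 : IsOpen 𝒰)
    (h𝒰n : 𝒰.Nonempty) : ∃ (n : ℕ) (a : Fin n → NNReal) (ha : ∑ k, a k = 1) (x : Fin n → X),
      mixture a ha (fun k => diracProba (x k)) ∈ 𝒰 := by
  obtain ⟨μ, hμ⟩ := h𝒰n
  have : Nonempty X := μ.nonempty
  let e : ℕ → X := TopologicalSpace.denseSeq X
  -- Projections to the nearest of the first N + 1 points of a dense sequence tend pointwise to the
  -- identity, so dominated convergence gives ν N → μ.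
  let ν : ℕ → ProbabilityMeasure X := fun N =>
    μ.map (SimpleFunc.nearestPt e N).measurable.aemeasurable
  have hν : Tendsto ν atTop (𝓝 μ) := by
    refine ProbabilityMeasure.tendsto_iff_forall_integral_tendsto.2 fun f => ?_
    have hint : ∀ N, ∫ x, f x ∂(ν N : Measure X) =
        ∫ x, f (SimpleFunc.nearestPt e N x) ∂(μ : Measure X) := fun N =>
      integral_map (SimpleFunc.nearestPt e N).measurable.aemeasurable
        f.continuous.aestronglyMeasurable
    simp only [hint]
    refine tendsto_integral_of_dominated_convergence (fun _ => ‖f‖)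
      (fun N => (f.continuous.measurable.comp
        (SimpleFunc.nearestPt e N).measurable).aestronglyMeasurable)
      (integrable_const _) (fun N => ae_of_all _ fun x => f.norm_coe_le_norm _)
      (ae_of_all _ fun x => ?_)
    exact (f.continuous.tendsto x).comp (SimpleFunc.tendsto_nearestPt
      ((TopologicalSpace.denseRange_denseSeq X).closure_eq ▸ mem_univ x))
  obtain ⟨N, hN⟩ := (hν.eventually (h𝒰.mem_nhds hμ)).exists
  let g : X → Fin (N + 1) := fun x =>
    ⟨SimpleFunc.nearestPtInd e N x, Nat.lt_succ_of_le (SimpleFunc.nearestPtInd_le e N x)⟩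
  have hg : Measurable g := by
    refine measurable_to_countable' fun k => ?_
    have : g ⁻¹' {k} = SimpleFunc.nearestPtInd e N ⁻¹' {(k : ℕ)} := by
      ext x
      simp [g, Fin.ext_iff]
    rw [this]
    exact (SimpleFunc.nearestPtInd e N).measurableSet_fiber _
  refine ⟨N + 1, _, sum_apply_fiber μ g hg, fun k => e k, ?_⟩
  have hνN : mixture _ (sum_apply_fiber μ g hg) (fun k => diracProba (e k)) = ν N :=
    ProbabilityMeasure.toMeasure_injective
      (coe_mixture_diracProba_eq_map μ g hg (fun k => e k) (sum_apply_fiber μ g hg))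
  rwa [hνN]

end DenseFiniteSupport

/-! ### Barycenters and almost dense periodic sets. -/

section Barycenter

variable {X : Type*} [MeasurableSpace X]

/-- The barycenter `∫ ν dm(ν)` of a probability measure on the space of probability measures. -/
def barycenter (m : ProbabilityMeasure (ProbabilityMeasure X)) : ProbabilityMeasure X :=
  ⟨((m : Measure (ProbabilityMeasure X)).map fun ν : ProbabilityMeasure X => (ν : Measure X)).join, by
    have : IsProbabilityMeasure
        ((m : Measure (ProbabilityMeasure X)).map fun ν : ProbabilityMeasure X => (ν : Measure X)) :=
      Measure.isProbabilityMeasure_map measurable_subtype_coe.aemeasurable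
    refine isProbabilityMeasure_join ?_
    have hs : MeasurableSet {μ : Measure X | IsProbabilityMeasure μ} := by
      simp only [isProbabilityMeasure_iff]
      exact Measure.measurable_coe MeasurableSet.univ (measurableSet_singleton 1)
    refine (ae_map_iff measurable_subtype_coe.aemeasurable hs).2 (ae_of_all _ fun ν => ?_)
    exact ν.2⟩

theorem barycenter_apply (m : ProbabilityMeasure (ProbabilityMeasure X)) {s : Set X}
    (hs : MeasurableSet s) : (barycenter m : Measure X) s =
      ∫⁻ ν : ProbabilityMeasure X, (ν : Measure X) s ∂(m : Measure (ProbabilityMeasure X)) := by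
  refine (Measure.join_apply hs).trans ?_
  exact lintegral_map (Measure.measurable_coe hs) measurable_subtype_coe

end Barycenter

section AlmostDensePeriodicSets

variable {X : Type*} [MetricSpace X] [CompactSpace X] [MeasurableSpace X] [BorelSpace X]
  {T : C(X, X)}

/-- Hence a barycenter inherits every period of the measure on M(X). -/
theorem semiconj_barycenter (T : C(X, X)) :
    Function.Semiconj barycenter (inducedMap (inducedMap T)) (inducedMap T) := by
  intro m
  refine ProbabilityMeasure.toMeasure_injective (Measure.ext fun s hs => ?_)
  have hT := T.continuous.measurable
  rw [barycenter_apply _ hs, coe_inducedMap, coe_inducedMap, Measure.map_apply hT hs,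
    barycenter_apply _ (hT hs)]
  have heval : Measurable fun ν : ProbabilityMeasure X => (ν : Measure X) s :=
    (Measure.measurable_coe hs).comp measurable_subtype_coe
  rw [lintegral_map heval (inducedMap T).continuous.measurable]
  refine lintegral_congr fun ν => ?_
  rw [coe_inducedMap, Measure.map_apply hT hs]

theorem HasAlmostDensePeriodicSets.of_inducedMap
    (h : HasAlmostDensePeriodicSets (inducedMap T)) : HasAlmostDensePeriodicSets T := by
  rintro U hU ⟨x, hx⟩ ε hε
  have h𝒰 := isOpen_setOf_apply_lt hU.isClosed_compl (ε / 2)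
  obtain ⟨k, hk, m, hmk, hm⟩ := h _ h𝒰
    ⟨diracProba x, by
      simp [ProbabilityMeasure.coeFn_def, hx, hε]⟩ (ε / 2) (half_pos hε)
  refine ⟨k, hk, barycenter m, ?_, ?_⟩
  · rw [← (semiconj_barycenter T).iterate_right k m, hmk]
  · set 𝒰 := {μ : ProbabilityMeasure X | (μ Uᶜ : ℝ) < ε / 2}
    -- The integrand ν(Uᶜ) is at most ε/2 on 𝒰 and at most 1 off it.
    have hle : (barycenter m : Measure X) Uᶜ ≤
        ENNReal.ofReal (ε / 2) + (m : Measure (ProbabilityMeasure X)) 𝒰ᶜ := by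
      rw [barycenter_apply _ hU.measurableSet.compl]
      calc ∫⁻ ν, (ν : Measure X) Uᶜ ∂(m : Measure (ProbabilityMeasure X))
          ≤ ∫⁻ ν, (ENNReal.ofReal (ε / 2) + 𝒰ᶜ.indicator 1 ν)
              ∂(m : Measure (ProbabilityMeasure X)) := by
            refine lintegral_mono fun ν => ?_
            by_cases hν : ν ∈ 𝒰
            · refine le_add_right (ENNReal.le_ofReal_iff_toReal_le (measure_ne_top _ _)
                (half_pos hε).le |>.2 (le_of_lt hν))
            · refine le_add_left ?_
              rw [indicator_of_mem (by exact hν)]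
              exact prob_le_one
        _ = _ := by
            rw [lintegral_add_left measurable_const, lintegral_const, measure_univ, mul_one,
              lintegral_indicator_one h𝒰.measurableSet.compl]
    have hlt : (barycenter m : Measure X) Uᶜ < ENNReal.ofReal ε := by
      refine hle.trans_lt ?_
      rw [← add_halves ε, ENNReal.ofReal_add (half_pos hε).le (half_pos hε).le, add_halves]
      exact ENNReal.add_lt_add_left ENNReal.ofReal_ne_top
        ((ENNReal.lt_ofReal_iff_toReal_lt (measure_ne_top _ _)).2 hm)
    exact (ENNReal.lt_ofReal_iff_toReal_lt (measure_ne_top _ _)).1 hlt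

/-- Periodic measures with mass less than 1/(n+1) outside the ball of radius 1/(n+1) about x
converge to δ_x, by the portmanteau criterion on open sets. -/
theorem HasAlmostDensePeriodicSets.diracProba_mem_closure (h : HasAlmostDensePeriodicSets T)
    (x : X) : diracProba x ∈ closure (periodicMeasures T) := by
  choose k hk μ hμk hμ using fun n : ℕ => h (Metric.ball x (1 / (n + 1 : ℝ))) Metric.isOpen_ball
    ⟨x, Metric.mem_ball_self Nat.one_div_pos_of_nat⟩ (1 / (n + 1 : ℝ)) Nat.one_div_pos_of_nat
  refine mem_closure_of_tendsto (f := μ) (b := atTop) ?_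
    (Eventually.of_forall fun n => ⟨k n, hk n, hμk n⟩)
  refine tendsto_of_forall_isOpen_le_liminf fun G hG => ?_
  by_cases hx : x ∈ G
  swap
  · simp [ProbabilityMeasure.coeFn_def, hx]
  have hlim : Tendsto (fun n => μ n G) atTop (𝓝 1) := by
    rw [← NNReal.tendsto_coe]
    have h1 : Tendsto (fun n : ℕ => 1 - 1 / (n + 1 : ℝ)) atTop (𝓝 ((1 : NNReal) : ℝ)) := by
      simpa using tendsto_one_div_add_atTop_nhds_zero_nat.const_sub (1 : ℝ)
    refine tendsto_of_tendsto_of_tendsto_of_le_of_le' h1 tendsto_const_nhds ?_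
      (Eventually.of_forall fun n => by simp)
    obtain ⟨r, hr, hrG⟩ := Metric.isOpen_iff.1 hG x hx
    filter_upwards [tendsto_one_div_add_atTop_nhds_zero_nat.eventually (gt_mem_nhds hr)]
      with n hn
    have h2 := (μ n).apply_union_le (s₁ := Metric.ball x (1 / (n + 1 : ℝ)))
      (s₂ := (Metric.ball x (1 / (n + 1 : ℝ)))ᶜ)
    rw [union_compl_self, ProbabilityMeasure.coeFn_univ] at h2
    have h3 : (1 : ℝ) ≤ μ n (Metric.ball x (1 / (n + 1 : ℝ))) +
        μ n (Metric.ball x (1 / (n + 1 : ℝ)))ᶜ := by exact_mod_cast h2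
    have h4 : (μ n (Metric.ball x (1 / (n + 1 : ℝ))) : ℝ) ≤ μ n G :=
      (μ n).apply_mono ((Metric.ball_subset_ball hn.le).trans hrG)
    linarith [hμ n]
  rw [hlim.liminf_eq]
  exact (diracProba x).apply_le_one G

theorem HasAlmostDensePeriodicSets.dense_periodicMeasures (h : HasAlmostDensePeriodicSets T) :
    Dense (periodicMeasures T) := by
  refine dense_iff_inter_open.2 fun 𝒰 h𝒰 h𝒰n => ?_
  obtain ⟨n, a, ha, x, hx⟩ := exists_mixture_diracProba_mem h𝒰 h𝒰n
  have hmem : (fun k => diracProba (x k)) ∈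
      closure (univ.pi fun _ : Fin n => periodicMeasures T) := by
    rw [closure_pi_set]
    exact fun k _ => h.diracProba_mem_closure (x k)
  have hcl : mixture a ha (fun k => diracProba (x k)) ∈ closure (periodicMeasures T) :=
    map_mem_closure continuous_mixture hmem fun μ hμ =>
      mixture_mem_periodicMeasures fun k => hμ k (mem_univ k)
  exact mem_closure_iff.1 hcl 𝒰 h𝒰 hx

end AlmostDensePeriodicSets

/-! ### Weak mixing of the map and transitivity of the induced map. -/

section WeakMixing

variable {X : Type*} [MetricSpace X] [MeasurableSpace X] [BorelSpace X]
  {T : C(X, X)}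

theorem IsTotallyTransitive.isWeaklyMixing (h : IsTotallyTransitive T)
    (hp : HasAlmostDensePeriodicSets T) (hs : Function.Surjective T) : IsWeaklyMixing T := by
  refine isWeaklyMixing_of_self_hittingTimes T.continuous hs ?_
  intro A B C hA hAn hB hBn hC hCn
  obtain ⟨k, hk, μ, hμk, hμ⟩ := hp C hC hCn (1 / 2) one_half_pos
  obtain ⟨n, hn⟩ := (h k hk).nonempty_hittingTimes hA hAn hB hBn
  have hn' : k * n ∈ hittingTimes T A B := by
    obtain ⟨x, hxA, hxB⟩ := mem_hittingTimes.1 hn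
    exact mem_hittingTimes.2 ⟨x, hxA, by rwa [Function.iterate_mul]⟩
  have hμn : (inducedMap T)^[k * n] μ = μ := by
    rw [Function.iterate_mul]
    exact Function.iterate_fixed hμk n
  have hC' : μ (T^[k * n] ⁻¹' Cᶜ) = μ Cᶜ := by
    rw [← inducedMap_iterate_apply _ _ hC.measurableSet.compl, hμn]
  -- C and its preimage under `T^[k * n]` both have mass above 1/2, so they meet.
  obtain ⟨x, hx, hx'⟩ := exists_notMem_of_apply_add_lt_one μ
    (s := Cᶜ) (t := T^[k * n] ⁻¹' Cᶜ) (by rw [hC']; linarith)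
  exact ⟨_, hn', mem_hittingTimes.2 ⟨x, not_not.1 hx, not_not.1 hx'⟩⟩

theorem IsTransitive.isWeaklyMixing_of_inducedMap (h : IsTransitive (inducedMap T))
    (hs : Function.Surjective T) : IsWeaklyMixing T := by
  refine isWeaklyMixing_of_common_target T.continuous hs ?_
  rintro A B C hA ⟨x, hx⟩ hB ⟨y, hy⟩ hC ⟨z, hz⟩
  -- The bound 2/3 exceeds the mass 1/2 that (δ_x + δ_y)/2 may leave outside A or B; 1/3 is what
  -- keeps the total below 1.
  have h𝒰 := (isOpen_setOf_apply_lt hA.isClosed_compl (2 / 3)).inter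
    (isOpen_setOf_apply_lt hB.isClosed_compl (2 / 3))
  have h𝒱 := isOpen_setOf_apply_lt hC.isClosed_compl (1 / 3)
  have ha : ∑ _i : Fin 2, (1 / 2 : NNReal) = 1 := by
    rw [Fin.sum_univ_two]
    exact add_halves 1
  have hmix : ∀ s : Set X, (x ∈ s ∨ y ∈ s) →
      (mixture _ ha ![diracProba x, diracProba y] sᶜ : ℝ) < 2 / 3 := by
    intro s hs
    have hle : (mixture _ ha ![diracProba x, diracProba y] : Measure X) sᶜ ≤ 1 / 2 := by
      rw [mixture_apply, Fin.sum_univ_two]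
      rcases hs with hs | hs
      · simpa [hs] using mul_le_mul_right (prob_le_one (μ := Measure.dirac y) (s := sᶜ)) 2⁻¹
      · simpa [hs] using mul_le_mul_right (prob_le_one (μ := Measure.dirac x) (s := sᶜ)) 2⁻¹
    have := ENNReal.toReal_mono (by simp) hle
    refine lt_of_le_of_lt this ?_
    norm_num
  obtain ⟨n, hn⟩ := h.nonempty_hittingTimes h𝒰
    ⟨_, hmix A (Or.inl hx), hmix B (Or.inr hy)⟩ h𝒱
    ⟨diracProba z, by simp [ProbabilityMeasure.coeFn_def, hz]⟩
  obtain ⟨μ, ⟨hμA, hμB⟩, hμC⟩ := mem_hittingTimes.1 hn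
  rw [mem_ofPred_eq] at hμA hμB hμC
  rw [inducedMap_iterate_apply _ _ hC.measurableSet.compl] at hμC
  obtain ⟨u, hu, hu'⟩ := exists_notMem_of_apply_add_lt_one μ (s := Aᶜ) (t := T^[n] ⁻¹' Cᶜ)
    (by linarith)
  obtain ⟨v, hv, hv'⟩ := exists_notMem_of_apply_add_lt_one μ (s := Bᶜ) (t := T^[n] ⁻¹' Cᶜ)
    (by linarith)
  exact ⟨n, mem_hittingTimes.2 ⟨u, not_not.1 hu, not_not.1 hu'⟩,
    mem_hittingTimes.2 ⟨v, not_not.1 hv, not_not.1 hv'⟩⟩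

/-- Weak-* neighbourhoods of a finitely supported measure contain all measures obtained by
moving the atoms slightly. -/
theorem exists_isOpen_forall_mixture_diracProba_mem {ι : Type*} [Fintype ι] {a : ι → NNReal}
    {ha : ∑ i, a i = 1} {𝒰 : Set (ProbabilityMeasure X)} (h𝒰 : IsOpen 𝒰) {x : ι → X}
    (hx : mixture a ha (fun i => diracProba (x i)) ∈ 𝒰) :
    ∃ U : ι → Set X, (∀ i, IsOpen (U i) ∧ x i ∈ U i) ∧
      ∀ z : ι → X, (∀ i, z i ∈ U i) → mixture a ha (fun i => diracProba (z i)) ∈ 𝒰 := by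
  have hc : Continuous fun z : ι → X => mixture a ha fun i => diracProba (z i) :=
    continuous_mixture.comp
      (continuous_pi fun i => continuous_diracProba.comp (continuous_apply i))
  obtain ⟨U, hU, hUs⟩ := isOpen_pi_iff'.1 (h𝒰.preimage hc) x hx
  exact ⟨U, hU, fun z hz => hUs fun i _ => hz i⟩

/-- Finitely supported measures in 𝒰 and 𝒱 are given the same weights; Furstenberg's lemma then
supplies common times carrying every atom near its partner. -/
theorem IsWeaklyMixing.isTotallyTransitive_inducedMap [CompactSpace X] (h : IsWeaklyMixing T)
    (hs : Function.Surjective T) : IsTotallyTransitive (inducedMap T) := by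
  intro k hk 𝒰 𝒱 h𝒰 h𝒰n h𝒱 h𝒱n
  have : Nonempty X := h𝒰n.some.nonempty
  obtain ⟨n, a, ha, x, hx⟩ := exists_mixture_diracProba_mem h𝒰 h𝒰n
  obtain ⟨m, b, hb, y, hy⟩ := exists_mixture_diracProba_mem h𝒱 h𝒱n
  have hab : ∑ p : Fin n × Fin m, a p.1 * b p.2 = 1 := by
    rw [Fintype.sum_prod_type, ← Finset.sum_mul_sum, ha, hb, one_mul]
  rw [← mixture_fst ha hb hab] at hx
  rw [← mixture_snd ha hb hab] at hy
  obtain ⟨U, hU, hU𝒰⟩ := exists_isOpen_forall_mixture_diracProba_mem h𝒰 hx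
  obtain ⟨V, hV, hV𝒱⟩ := exists_isOpen_forall_mixture_diracProba_mem h𝒱 hy
  obtain ⟨A, B, hA, hAn, hB, hBn, hAB⟩ := h.exists_hittingTimes_subset_iInter T.continuous
    Finset.univ U V (fun p => (hU p).1) (fun p => ⟨_, (hU p).2⟩)
    (fun p => (hV p).1) (fun p => ⟨_, (hV p).2⟩)
  refine ((h.isTotallyTransitive T.continuous hs) k hk A B hA hAn hB hBn).mono fun l hl => ?_
  have hl' : k * l ∈ hittingTimes T A B := by
    obtain ⟨z, hzA, hzB⟩ := mem_hittingTimes.1 hl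
    exact mem_hittingTimes.2 ⟨z, hzA, by rwa [Function.iterate_mul]⟩
  choose z hzU hzV using fun p => mem_hittingTimes.1 (hAB _ hl' p (Finset.mem_univ p))
  refine mem_hittingTimes.2 ⟨_, hU𝒰 z hzU, ?_⟩
  rw [← Function.iterate_mul, inducedMap_iterate_mixture]
  simp only [inducedMap_iterate_diracProba]
  exact hV𝒱 _ hzV

end WeakMixing

/-! ### Ergodic measures as extreme points. -/

section ErgodicMeasures

variable {X : Type*} [MetricSpace X] [MeasurableSpace X] [BorelSpace X]

/-- The map sending a probability measure to the functional it induces on continuous functions. -/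
def integralFunctional (μ : ProbabilityMeasure X) : BoundedContinuousFunction X ℝ → ℝ :=
  fun f => ∫ x, f x ∂(μ : Measure X)

/-- Together with injectivity, this places M(X) inside a real locally convex space, where extreme
points of compact sets exist. -/
theorem continuous_integralFunctional : Continuous (integralFunctional (X := X)) :=
  continuous_pi fun f => continuous_iff_continuousAt.2 fun μ =>
    ProbabilityMeasure.tendsto_iff_forall_integral_tendsto.1 (continuous_id.tendsto μ) f

theorem integralFunctional_injective : Function.Injective (integralFunctional (X := X)) :=
  fun _ _ h => ProbabilityMeasure.toMeasure_injective
    (ext_of_forall_integral_eq_of_IsFiniteMeasure fun f => congrFun h f)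

theorem isClosed_setOf_measurePreserving {S : X → X} (hS : Continuous S) :
    IsClosed {μ : ProbabilityMeasure X | MeasurePreserving S (μ : Measure X) μ} := by
  convert isClosed_eq (inducedMap ⟨S, hS⟩).continuous continuous_id using 1
  ext μ
  exact inducedMap_iterate_eq_self_iff (T := ⟨S, hS⟩) (n := 1).symm

/-- A decomposition of the measure with `ENNReal` weights gives one of its functional with real
weights, so extremality passes back to measures. -/
theorem ergodic_of_integralFunctional_mem_extremePoints {S : X → X} {μ : ProbabilityMeasure X}
    (h : integralFunctional μ ∈ extremePoints ℝ (integralFunctional ''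
      {ν : ProbabilityMeasure X | MeasurePreserving S (ν : Measure X) ν})) :
    Ergodic S (μ : Measure X) := by
  obtain ⟨⟨μ', hμ', hμμ'⟩, hext⟩ := h
  obtain rfl := integralFunctional_injective hμμ'
  refine Ergodic.of_mem_extremePoints ⟨⟨hμ', inferInstance⟩, ?_⟩
  rintro ν₁ ⟨hν₁, hp₁⟩ ν₂ ⟨hν₂, hp₂⟩ ⟨a, b, ha, hb, hab, heq⟩
  have ha' : a ≠ ⊤ := ((le_self_add.trans hab.le).trans_lt ENNReal.one_lt_top).ne
  have hb' : b ≠ ⊤ := ((le_add_self.trans hab.le).trans_lt ENNReal.one_lt_top).ne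
  have hμν : integralFunctional ⟨ν₁, hp₁⟩ = integralFunctional μ' := by
    refine hext ⟨⟨ν₁, hp₁⟩, hν₁, rfl⟩ ⟨⟨ν₂, hp₂⟩, hν₂, rfl⟩
      ⟨a.toReal, b.toReal, ENNReal.toReal_pos ha.ne' ha', ENNReal.toReal_pos hb.ne' hb', ?_, ?_⟩
    · rw [← ENNReal.toReal_add ha' hb', hab, ENNReal.toReal_one]
    · funext f
      change a.toReal * ∫ x, f x ∂ν₁ + b.toReal * ∫ x, f x ∂ν₂ = ∫ x, f x ∂(μ' : Measure X)
      rw [← heq, integral_add_measure ((f.integrable ν₁).smul_measure ha')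
        ((f.integrable ν₂).smul_measure hb'), integral_smul_measure, integral_smul_measure]
      rfl
  exact congrArg ProbabilityMeasure.toMeasure (integralFunctional_injective hμν)

/-- An invariant measure giving small mass to a closed set can be replaced by an ergodic one. -/
theorem exists_ergodic_apply_lt [CompactSpace X] {S : X → X} (hS : Continuous S) {μ : ProbabilityMeasure X}
    (hμ : MeasurePreserving S (μ : Measure X) μ) {F : Set X} (hF : IsClosed F) {ε : ℝ}
    (hμF : (μ F : ℝ) < ε) :
    ∃ ν : ProbabilityMeasure X, Ergodic S (ν : Measure X) ∧ (ν F : ℝ) < ε := by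
  -- Mass on F is not continuous in the measure, so it is replaced by the integral of a continuous
  -- majorant still below ε at μ.
  obtain ⟨n, hn⟩ := ((HasOuterApproxClosed.tendsto_lintegral_apprSeq hF
    (μ : Measure X)).eventually_lt_const
      ((ENNReal.lt_ofReal_iff_toReal_lt (measure_ne_top _ _)).2 hμF)).exists
  let f : BoundedContinuousFunction X ℝ := BoundedContinuousFunction.mkOfCompact
    ⟨fun x => (hF.apprSeq n x : ℝ), NNReal.continuous_coe.comp (hF.apprSeq n).continuous⟩
  have hf : ∀ ν : ProbabilityMeasure X, integralFunctional ν f =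
      (∫⁻ x, hF.apprSeq n x ∂(ν : Measure X)).toReal := fun ν =>
    (BoundedContinuousFunction.toReal_lintegral_coe_eq_integral (hF.apprSeq n) ν).symm
  have hfin : ∀ ν : ProbabilityMeasure X, ∫⁻ x, hF.apprSeq n x ∂(ν : Measure X) ≠ ⊤ := fun ν =>
    (BoundedContinuousFunction.lintegral_lt_top_of_nnreal _ _).ne
  set K := integralFunctional ''
    {ν : ProbabilityMeasure X | MeasurePreserving S (ν : Measure X) ν}
  have hK : IsCompact K :=
    (isClosed_setOf_measurePreserving hS).isCompact.image continuous_integralFunctional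
  -- The sign makes the face exposed by `l` the set of minimizers of ∫ f; an extreme point of this
  -- face is extreme in `K`.
  let l : StrongDual ℝ (BoundedContinuousFunction X ℝ → ℝ) :=
    -(ContinuousLinearMap.proj (R := ℝ) (φ := fun _ : BoundedContinuousFunction X ℝ => ℝ) f)
  have hexp : IsExposed ℝ K (l.toExposed K) := ContinuousLinearMap.toExposed.isExposed
  obtain ⟨p, hpK, hp⟩ := hK.exists_isMaxOn ⟨_, μ, hμ, rfl⟩ l.continuous.continuousOn
  obtain ⟨e, he⟩ := (hexp.isCompact hK).extremePoints_nonempty ⟨p, hpK, fun y hy => hp hy⟩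
  have heK : e ∈ extremePoints ℝ K := hexp.isExtreme.extremePoints_subset_extremePoints he
  obtain ⟨ν, hν, rfl⟩ := heK.1
  refine ⟨ν, ergodic_of_integralFunctional_mem_extremePoints heK, ?_⟩
  have hle : integralFunctional ν f ≤ integralFunctional μ f :=
    neg_le_neg_iff.1 (he.1.2 _ ⟨μ, hμ, rfl⟩)
  have h1 : (ν F : ℝ) ≤ integralFunctional ν f := by
    rw [hf]
    exact ENNReal.toReal_mono (hfin ν) (HasOuterApproxClosed.measure_le_lintegral hF _ n)
  have h2 : integralFunctional μ f < ε := by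
    rw [hf]
    exact (ENNReal.lt_ofReal_iff_toReal_lt (hfin μ)).1 hn
  linarith

end ErgodicMeasures

end InducedSystem

end

/-! ### The cycle of implications. -/

theorem theorem4p10 {X : Type*} [MetricSpace X] [CompactSpace X] [MeasurableSpace X]
    [BorelSpace X] (T : C(X, X)) (hT : Function.Surjective T) :
    List.TFAE [
      InducedSystem.IsAlmostHYSystem T,
      InducedSystem.IsWeaklyMixing T ∧
        ∀ U : Set X, IsOpen U → U.Nonempty → ∀ ε : ℝ, 0 < ε →
          ∃ k : ℕ, 1 ≤ k ∧ ∃ μ : ProbabilityMeasure X,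
            Ergodic (T^[k]) (μ : Measure X) ∧ (μ Uᶜ : ℝ) < ε,
      InducedSystem.IsPSystem (InducedSystem.inducedMap T),
      InducedSystem.IsAlmostHYSystem (InducedSystem.inducedMap T)] := by
  tfae_have 1 → 2 := by
    rintro ⟨htt, hp⟩
    refine ⟨htt.isWeaklyMixing hp hT, fun U hU hUn ε hε => ?_⟩
    obtain ⟨k, hk, μ, hμk, hμ⟩ := hp U hU hUn ε hε
    exact ⟨k, hk, InducedSystem.exists_ergodic_apply_lt (T.continuous.iterate k)
      (InducedSystem.inducedMap_iterate_eq_self_iff.1 hμk) hU.isClosed_compl hμ⟩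
  tfae_have 2 → 3 := by
    rintro ⟨hwm, he⟩
    have hp : InducedSystem.HasAlmostDensePeriodicSets T := fun U hU hUn ε hε => by
      obtain ⟨k, hk, μ, hμk, hμ⟩ := he U hU hUn ε hε
      exact ⟨k, hk, μ,
        InducedSystem.inducedMap_iterate_eq_self_iff.2 hμk.toMeasurePreserving, hμ⟩
    exact ⟨(hwm.isTotallyTransitive_inducedMap hT).isTransitive, hp.dense_periodicMeasures⟩
  tfae_have 3 → 4 := fun ⟨htr, hd⟩ =>
    ⟨(htr.isWeaklyMixing_of_inducedMap hT).isTotallyTransitive_inducedMap hT,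
      InducedSystem.HasAlmostDensePeriodicSets.of_dense_periodic hd⟩
  tfae_have 4 → 1 := fun ⟨htt, hp⟩ =>
    ⟨(htt.isTransitive.isWeaklyMixing_of_inducedMap hT).isTotallyTransitive T.continuous hT,
      hp.of_inducedMap⟩
  tfae_finish
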